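/- An MT-algebra is a complete boolean algebra $M$ with an interior operator $\square$ (i.e. $\square 1=1$, $\square(a\wedge b)=\square a\wedge\square b$, $\square a\le a$, $\square a\le\square\square a$); put $\diamond a=\neg\square\neg a$. An MT-morphism is a complete boolean homomorphism $f$ with $f(\square a)\le\square f(a)$ for all $a$. Let $\mathbf{MT}$ be the category of MT-algebras and MT-morphisms. An element $a$ is open if $a=\square a$, and $\mathcal O:\mathbf{MT}\to\mathbf{Frm}$ sends $M$ to the frame of its open elements and $f$ to its restriction to open elements. $M$ is compact if every family of open elements with join $1$ has a finite subfamily with join $1$; $M$ is Hausdorff if every element is a join of elements $a$ satisfying $a=\bigwedge\{\diamond\square c\mid a\le\square c\}$; $M$ is spatial if it is atomic. Let $\mathcal P:\mathbf{Top}\to\mathbf{MT}$ be the contravariant functor sending a space $X$ to its powerset with the interior operator and a continuous map $f$ to $f^{-1}$. Let $\mathrm{at}:\mathbf{MT}\to\mathbf{Top}$ be the contravariant functor sending $M$ to the set of its atoms with open sets $\eta(u)=\{x\mid x\le u\}$ ($u$ open), and an MT-morphism to the restriction of its left adjoint. These form a dual adjunction with units $\varepsilon(x)=\{x\}$ and $\eta(a)=\{x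 \text{ atom}\mid x\le a\}$, which restricts to a dual equivalence between $\mathbf{Top}$ and spatial MT-algebras (MT duality). A frame $L$ is compact if every subset with join $1$ has a finite subset with join $1$, and regular if $a=\bigvee\{b\mid b^*\vee a=1\}$ for all $a\in L$, where $b^*$ is the pseudocomplement of $b$. Let $\mathbf{KHMT}\subseteq\mathbf{MT}$, $\mathbf{KRegFrm}\subseteq\mathbf{Frm}$ and $\mathbf{KHaus}\subseteq\mathbf{Top}$ be the full subcategories of compact Hausdorff MT-algebras, compact regular frames, and compact Hausdorff spaces, respectively. Then: 1. $\mathcal O$ restricts to an equivalence $\mathbf{KHMT}\to\mathbf{KRegFrm}$. 2. Every compact Hausdorff MT-algebra is spatial, and MT duality restricts to a dual equivalence between $\mathbf{KHMT}$ and $\mathbf{KHaus}$: the functors $\mathcal P$ and $\mathrm{at}$ restrict to dual equivalences between these subcategories, and $\varepsilon$ and $\eta$ are isomorphisms on their objects. 3. (Isbell duality) $\mathbf{KRegFrm}$ is dually equivalent to $\mathbf{KHaus}$. More precisely, the dual adjunction between $\mathbf{Top}$ and $\mathbf{Frm}$ given by the contravariant functor $\Omega$ of open sets and the contravariant functor $\mathrm{pt}$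 of points restricts to such a dual equivalence: $\Omega$ and $\mathrm{pt}$ restrict to dual equivalences between $\mathbf{KHaus}$ and $\mathbf{KRegFrm}$, and the two units of the adjunction are isomorphisms on their objects. -/

import Mathlib

open CategoryTheory Opposite TopologicalSpace

universe u v w

/-! ### MT-algebras and their morphisms -/

/-- A McKinsey-Tarski algebra: a complete boolean algebra with an interior operator `box`. -/
class MTAlgebra (B : Type u) extends CompleteBooleanAlgebra B where
  /-- The interior operator. -/
  box : B → B
  box_top : box ⊤ = ⊤
  box_inf : ∀ a b : B, box (a ⊓ b) = box a ⊓ box b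
  box_le : ∀ a : B, box a ≤ a
  box_le_box_box : ∀ a : B, box a ≤ box (box a)

namespace MTAlgebra

variable {B : Type u} [MTAlgebra B]

/-- The closure operator dual to the interior operator. -/
def dia (a : B) : B := (box aᶜ)ᶜ

/-- An element is open if it is a fixed point of the interior operator. -/
def IsOpenElt (a : B) : Prop := a = box a

theorem box_mono {a b : B} (h : a ≤ b) : box a ≤ box b := by
  have h1 : box a = box a ⊓ box b := by rw [← box_inf, inf_eq_left.mpr h]
  rw [h1]
  exact inf_le_right

theorem isOpenElt_of_le {a : B} (h : a ≤ box a) : IsOpenElt a := le_antisymm h (box_le a)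

theorem isOpenElt_box (a : B) : IsOpenElt (box a) := isOpenElt_of_le (box_le_box_box a)

theorem isOpenElt_top : IsOpenElt (⊤ : B) := box_top.symm

theorem isOpenElt_inf {a b : B} (ha : IsOpenElt a) (hb : IsOpenElt b) : IsOpenElt (a ⊓ b) := by
  unfold IsOpenElt at *
  rw [box_inf, ← ha, ← hb]

theorem isOpenElt_sSup {S : Set B} (hS : ∀ a ∈ S, IsOpenElt a) : IsOpenElt (sSup S) :=
  isOpenElt_of_le (sSup_le fun a ha => (hS a ha).le.trans (box_mono (le_sSup ha)))

/-- A subset `S` join-generates `B` if every element of `B` is a join of elements of `S`. -/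
def JoinGenerates (S : Set B) : Prop := ∀ a : B, ∃ T ⊆ S, a = sSup T

/-- An element is compact if every cover of it by open elements has a finite subcover. -/
def IsCompactElt (a : B) : Prop :=
  ∀ S : Set B, (∀ s ∈ S, IsOpenElt s) → a ≤ sSup S → ∃ T ⊆ S, T.Finite ∧ a ≤ sSup T

/-- An element is approximated from above by regular closed elements. -/
def IsApproxFromAbove (a : B) : Prop := a = sInf {d | ∃ c : B, a ≤ box c ∧ d = dia (box c)}

variable (B) in
/-- An MT-algebra is compact if its top element is compact. -/
def IsCompact : Prop := IsCompactElt (⊤ : B)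

variable (B) in
/-- An MT-algebra is Hausdorff if the elements approximated from above by regular closed elements
join-generate it. -/
def IsHausdorff : Prop := JoinGenerates {a : B | IsApproxFromAbove a}

end MTAlgebra

/-- An MT-morphism: a complete boolean homomorphism `f` with `f (box a) ≤ box (f a)`. (A map between
boolean algebras that preserves all joins and all meets also preserves complements.) -/
structure MTHom (M : Type u) (N : Type v) [MTAlgebra M] [MTAlgebra N] extends
    CompleteLatticeHom M N where
  map_box_le' : ∀ a : M, toFun (MTAlgebra.box a) ≤ MTAlgebra.box (toFun a)

namespace MTHom

variable {M : Type u} {N : Type v} {K : Type w} [MTAlgebra M] [MTAlgebra N] [MTAlgebra K]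

instance : FunLike (MTHom M N) M N where
  coe f := f.toFun
  coe_injective f g h := by
    obtain ⟨⟨⟨_, _⟩, _⟩, _⟩ := f
    obtain ⟨⟨⟨_, _⟩, _⟩, _⟩ := g
    congr

instance : CompleteLatticeHomClass (MTHom M N) M N where
  map_sSup f := f.map_sSup'
  map_sInf f := f.map_sInf'

theorem map_box_le (f : MTHom M N) (a : M) : f (MTAlgebra.box a) ≤ MTAlgebra.box (f a) :=
  f.map_box_le' a

@[ext]
theorem ext {f g : MTHom M N} (h : ∀ a, f a = g a) : f = g := DFunLike.ext f g h

variable (M) in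
/-- The identity MT-morphism. -/
def id : MTHom M M where
  toCompleteLatticeHom := CompleteLatticeHom.id M
  map_box_le' _ := le_rfl

/-- Composition of MT-morphisms. -/
def comp (g : MTHom N K) (f : MTHom M N) : MTHom M K where
  toCompleteLatticeHom := g.toCompleteLatticeHom.comp f.toCompleteLatticeHom
  map_box_le' a := (OrderHomClass.mono g (f.map_box_le a)).trans (g.map_box_le (f a))

@[simp] theorem id_apply (a : M) : MTHom.id M a = a := rfl

@[simp] theorem comp_apply (g : MTHom N K) (f : MTHom M N) (a : M) : g.comp f a = g (f a) := rfl

theorem map_isOpenElt (f : MTHom M N) {a : M} (ha : MTAlgebra.IsOpenElt a) :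
    MTAlgebra.IsOpenElt (f a) :=
  MTAlgebra.isOpenElt_of_le ((congrArg f ha).le.trans (f.map_box_le a))

end MTHom

/-- The category of MT-algebras and MT-morphisms. -/
structure MTCat where
  /-- The underlying type. -/
  carrier : Type u
  [str : MTAlgebra carrier]

namespace MTCat

attribute [instance] MTCat.str

instance : CoeSort MTCat (Type u) := ⟨MTCat.carrier⟩

instance : Category MTCat.{u} where
  Hom M N := MTHom M N
  id M := MTHom.id M
  comp f g := MTHom.comp g f

/-- The MT-morphism underlying a morphism of the category. -/
abbrev Hom.toMTHom {M N : MTCat.{u}} (f : M ⟶ N) : MTHom M N := f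

end MTCat

/-! ### The frame of open elements -/

/-- The open elements of an MT-algebra, with the order of the algebra. -/
abbrev OpenElts (B : Type u) [MTAlgebra B] : Type u := {a : B // MTAlgebra.IsOpenElt a}

namespace OpenElts

open MTAlgebra

variable {B : Type u} [MTAlgebra B]

instance : CompleteLattice (OpenElts B) where
  inf a b := ⟨a.1 ⊓ b.1, isOpenElt_inf a.2 b.2⟩
  inf_le_left a b := show a.1 ⊓ b.1 ≤ a.1 from inf_le_left
  inf_le_right a b := show a.1 ⊓ b.1 ≤ b.1 from inf_le_right
  le_inf a b c hab hac := show a.1 ≤ b.1 ⊓ c.1 from le_inf hab hac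
  sup a b := ⟨a.1 ⊔ b.1, isOpenElt_of_le (sup_le
    (a.2.le.trans (box_mono le_sup_left)) (b.2.le.trans (box_mono le_sup_right)))⟩
  le_sup_left a b := show a.1 ≤ a.1 ⊔ b.1 from le_sup_left
  le_sup_right a b := show b.1 ≤ a.1 ⊔ b.1 from le_sup_right
  sup_le a b c hac hbc := show a.1 ⊔ b.1 ≤ c.1 from sup_le hac hbc
  sSup S := ⟨sSup (Subtype.val '' S), isOpenElt_sSup (by rintro _ ⟨a, _, rfl⟩; exact a.2)⟩
  isLUB_sSup S := ⟨fun a ha => show a.1 ≤ sSup _ from le_sSup ⟨a, ha, rfl⟩,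
    fun b hb => show sSup _ ≤ b.1 from sSup_le (by rintro _ ⟨a, ha, rfl⟩; exact hb ha)⟩
  sInf S := ⟨box (sInf (Subtype.val '' S)), isOpenElt_box _⟩
  isGLB_sInf S := ⟨fun a ha => show box (sInf _) ≤ a.1 from (box_le _).trans (sInf_le ⟨a, ha, rfl⟩),
    fun b hb => show b.1 ≤ box (sInf _) from b.2.le.trans (box_mono
      (le_sInf (by rintro _ ⟨a, ha, rfl⟩; exact hb ha)))⟩
  top := ⟨⊤, isOpenElt_top⟩
  le_top a := show a.1 ≤ ⊤ from le_top
  bot := ⟨⊥, isOpenElt_of_le bot_le⟩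
  bot_le a := show ⊥ ≤ a.1 from bot_le

@[simp] theorem coe_inf (a b : OpenElts B) : (a ⊓ b).1 = a.1 ⊓ b.1 := rfl
@[simp] theorem coe_top : (⊤ : OpenElts B).1 = ⊤ := rfl
theorem coe_sSup (S : Set (OpenElts B)) : (sSup S).1 = sSup (Subtype.val '' S) := rfl

instance : Order.Frame (OpenElts B) :=
  Order.Frame.ofMinimalAxioms
    { inf_sSup_le_iSup_inf := fun a S => by
        change a.1 ⊓ sSup (Subtype.val '' S) ≤ (⨆ b ∈ S, a ⊓ b).1
        rw [inf_sSup_eq]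
        refine iSup₂_le ?_
        rintro _ ⟨b, hb, rfl⟩
        exact (le_iSup₂ (f := fun (b : OpenElts B) (_ : b ∈ S) => a ⊓ b) b hb :) }

/-- The restriction of an MT-morphism to the open elements. -/
def map {M : Type u} {N : Type v} [MTAlgebra M] [MTAlgebra N] (f : MTHom M N) :
    FrameHom (OpenElts M) (OpenElts N) where
  toFun a := ⟨f a.1, f.map_isOpenElt a.2⟩
  map_inf' a b := Subtype.ext (map_inf f a.1 b.1)
  map_top' := Subtype.ext (map_top f)
  map_sSup' S := Subtype.ext (by
    change f (sSup (Subtype.val '' S)) = sSup (Subtype.val '' _)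
    rw [map_sSup, Set.image_image, Set.image_image])

end OpenElts

namespace MTCat

/-- The functor sending an MT-algebra to the frame of its open elements and an MT-morphism to its
restriction to open elements. -/
def openFunctor : MTCat.{u} ⥤ Frm.{u} where
  obj M := Frm.of (OpenElts M)
  map f := Frm.ofHom (OpenElts.map (Hom.toMTHom f))

end MTCat

/-! ### The dual adjunction between topological spaces and MT-algebras -/

/-- The powerset of a topological space as an MT-algebra. -/
abbrev powersetMT (X : Type u) [TopologicalSpace X] : MTAlgebra (Set X) where
  box := interior
  box_top := interior_univ
  box_inf _ _ := interior_inter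
  box_le _ := interior_subset
  box_le_box_box _ := interior_interior.ge

/-- The contravariant powerset functor: a space goes to its powerset with the topological interior,
a continuous map to the inverse image map. -/
def powersetFunctor : TopCat.{u}ᵒᵖ ⥤ MTCat.{u} where
  obj X := @MTCat.mk (Set X.unop) (powersetMT X.unop)
  map f :=
    letI := powersetMT
    ({ toCompleteLatticeHom := CompleteLatticeHom.setPreimage f.unop
       map_box_le' := fun _ => preimage_interior_subset_interior_preimage
        f.unop.hom.continuous } : MTHom _ _)

/-- The atoms of an MT-algebra. -/
def MTAtoms (M : Type u) [MTAlgebra M] : Type u := {x : M // IsAtom x}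

namespace MTAtoms

variable {M : Type u} {N : Type v} [MTAlgebra M] [MTAlgebra N]

/-- The set of atoms below a given element. -/
def eta (a : M) : Set (MTAtoms M) := {x | x.1 ≤ a}

theorem eta_sInf (S : Set M) : eta (sInf S) = ⨅ a ∈ S, eta a := by
  ext x
  simp [eta, Set.mem_iInter]

theorem eta_sSup (S : Set M) : eta (sSup S) = ⨆ a ∈ S, eta a := by
  ext x
  simp only [eta, Set.mem_ofPred_eq, Set.iSup_eq_iUnion, Set.mem_iUnion]
  constructor
  · intro h
    by_contra hcon
    push Not at hcon
    have hd : x.1 ⊓ sSup S = ⊥ := by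
      rw [inf_sSup_eq]
      refine iSup₂_eq_bot.mpr fun a ha => ?_
      rcases x.2.le_iff.mp (inf_le_left : x.1 ⊓ a ≤ x.1) with h0 | h0
      · exact h0
      · exact absurd (inf_eq_left.mp h0) (hcon a ha)
    exact x.2.1 (by rw [← hd, inf_eq_left.mpr h])
  · rintro ⟨a, ha, hxa⟩
    exact hxa.trans (le_sSup ha)

/-- The open sets of atoms are the sets of the form `eta u` with `u` open. -/
instance : TopologicalSpace (MTAtoms M) where
  IsOpen U := ∃ u : M, MTAlgebra.IsOpenElt u ∧ eta u = U
  isOpen_univ := ⟨⊤, MTAlgebra.isOpenElt_top, by ext x; simp [eta]⟩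
  isOpen_inter := by
    rintro _ _ ⟨u, hu, rfl⟩ ⟨v, hv, rfl⟩
    exact ⟨u ⊓ v, MTAlgebra.isOpenElt_inf hu hv, by ext x; simp [eta]⟩
  isOpen_sUnion := by
    intro S hS
    refine ⟨sSup {u | MTAlgebra.IsOpenElt u ∧ eta u ∈ S},
      MTAlgebra.isOpenElt_sSup fun a ha => ha.1, ?_⟩
    rw [eta_sSup]
    ext x
    simp only [Set.iSup_eq_iUnion, Set.mem_iUnion, Set.mem_sUnion]
    constructor
    · rintro ⟨u, hu, hx⟩
      exact ⟨_, hu.2, hx⟩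
    · rintro ⟨U, hU, hx⟩
      obtain ⟨u, hu, rfl⟩ := hS U hU
      exact ⟨u, ⟨hu, hU⟩, hx⟩

theorem isOpen_iff (U : Set (MTAtoms M)) :
    IsOpen U ↔ ∃ u : M, MTAlgebra.IsOpenElt u ∧ eta u = U := Iff.rfl

/-- The left adjoint of an MT-morphism. -/
def lower (f : MTHom M N) (x : N) : M := sInf {a | x ≤ f a}

theorem lower_le_iff (f : MTHom M N) (x : N) (a : M) : lower f x ≤ a ↔ x ≤ f a := by
  constructor
  · intro h
    refine le_trans ?_ (OrderHomClass.mono f h)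
    rw [lower, map_sInf]
    exact le_sInf (by rintro _ ⟨b, hb, rfl⟩; exact hb)
  · intro h
    exact sInf_le h

theorem isAtom_lower (f : MTHom M N) {x : N} (hx : IsAtom x) : IsAtom (lower f x) := by
  refine ⟨fun h => hx.1 ?_, fun z hz => ?_⟩
  · have := (lower_le_iff f x ⊥).mp h.le
    rwa [map_bot, le_bot_iff] at this
  · have hnot : ¬ x ≤ f z := fun h => (lt_of_lt_of_le hz ((lower_le_iff f x z).mpr h)).false
    have hbot : x ⊓ f z = ⊥ := by
      rcases hx.le_iff.mp (inf_le_left : x ⊓ f z ≤ x) with h0 | h0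
      · exact h0
      · exact absurd (inf_eq_left.mp h0) hnot
    have hsup : x ≤ f z ⊔ f zᶜ := by rw [← map_sup, sup_compl_eq_top, map_top]; exact le_top
    have hc : x ≤ f zᶜ := by
      have : x = x ⊓ (f z ⊔ f zᶜ) := (inf_eq_left.mpr hsup).symm
      rw [inf_sup_left, hbot, bot_sup_eq] at this
      exact this ▸ inf_le_right
    have hz' : z ≤ zᶜ := hz.le.trans ((lower_le_iff f x _).mpr hc)
    exact le_bot_iff.mp ((le_inf le_rfl hz').trans (inf_compl_self z).le)

/-- The map on atoms induced by an MT-morphism: the restriction of its left adjoint. -/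
def map (f : MTHom M N) (x : MTAtoms N) : MTAtoms M := ⟨lower f x.1, isAtom_lower f x.2⟩

theorem map_le_iff (f : MTHom M N) (x : MTAtoms N) (a : M) : (map f x).1 ≤ a ↔ x.1 ≤ f a :=
  lower_le_iff f x.1 a

theorem preimage_map_eta (f : MTHom M N) (a : M) : map f ⁻¹' eta a = eta (f a) := by
  ext x
  exact map_le_iff f x a

theorem continuous_map (f : MTHom M N) : Continuous (map f) := by
  refine continuous_def.mpr ?_
  rintro _ ⟨u, hu, rfl⟩
  exact ⟨f u, f.map_isOpenElt hu, (preimage_map_eta f u).symm⟩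

theorem ext_le {x y : MTAtoms M} (h : ∀ a, x.1 ≤ a ↔ y.1 ≤ a) : x = y :=
  Subtype.ext (le_antisymm ((h _).mpr le_rfl) ((h _).mp le_rfl))

/-- `eta` as an MT-morphism to the powerset of the space of atoms. -/
def etaHom (M : Type u) [MTAlgebra M] :
    letI := powersetMT (MTAtoms M)
    MTHom M (Set (MTAtoms M)) :=
  letI := powersetMT (MTAtoms M)
  { toFun := eta
    map_sInf' := fun S => by rw [eta_sInf, sInf_image]
    map_sSup' := fun S => by rw [eta_sSup, sSup_image]
    map_box_le' := fun a => interior_maximal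
      (fun _ hx => le_trans hx (MTAlgebra.box_le a))
      ⟨MTAlgebra.box a, MTAlgebra.isOpenElt_box a, rfl⟩ }

end MTAtoms

/-- The contravariant functor sending an MT-algebra to its space of atoms. -/
def atomFunctor : MTCat.{u}ᵒᵖ ⥤ TopCat.{u} where
  obj M := TopCat.of (MTAtoms M.unop)
  map f := TopCat.ofHom ⟨MTAtoms.map (MTCat.Hom.toMTHom f.unop), MTAtoms.continuous_map _⟩
  map_id M := by
    ext x
    exact MTAtoms.ext_le fun a => MTAtoms.map_le_iff _ _ _
  map_comp f g := by
    ext x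
    refine MTAtoms.ext_le fun a => (MTAtoms.map_le_iff _ _ _).trans ?_
    exact ((MTAtoms.map_le_iff _ _ _).trans (MTAtoms.map_le_iff _ _ _)).symm

/-- The map sending a point `x` to the atom `{x}` of the powerset. -/
def epsilon (X : TopCat.{u}) :
    X ⟶ atomFunctor.obj (op (powersetFunctor.obj (op X))) :=
  TopCat.ofHom
    { toFun := fun x => ⟨({x} : Set X), Set.isAtom_singleton x⟩
      continuous_toFun := by
        refine continuous_def.mpr ?_
        rintro _ ⟨u, hu, rfl⟩
        have hu' : IsOpen (show Set X from u) := by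
          have h : (show Set X from u) = interior (show Set X from u) := hu
          rw [h]
          exact isOpen_interior
        convert hu' using 1
        ext x
        exact Set.singleton_subset_iff }

/-- The dual adjunction between topological spaces and MT-algebras, with units
`x ↦ {x}` and `a ↦ {x atom | x ≤ a}`. -/
def adjunctionTopMT : powersetFunctor.{u}.rightOp ⊣ atomFunctor.{u} where
  unit :=
    { app := epsilon
      naturality := fun X Y f => by
        ext x
        refine MTAtoms.ext_le fun a => Iff.symm ((MTAtoms.map_le_iff _ _ _).trans ?_)
        exact Set.singleton_subset_iff.trans (Set.singleton_subset_iff (a := f x)).symm }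
  counit :=
    { app := fun M => Quiver.Hom.op (MTAtoms.etaHom M.unop)
      naturality := fun M N f => by
        refine Quiver.Hom.unop_inj ?_
        refine MTHom.ext fun a => ?_
        exact (MTAtoms.preimage_map_eta (MTCat.Hom.toMTHom f.unop) a) }
  left_triangle_components X := by
    refine Quiver.Hom.unop_inj ?_
    refine MTHom.ext fun a => ?_
    exact Set.ext fun x => Set.singleton_subset_iff
  right_triangle_components M := by
    ext x
    refine MTAtoms.ext_le fun a => (MTAtoms.map_le_iff _ _ _).trans ?_
    exact Set.singleton_subset_iff

/-! ### Frames and spaces -/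

/-- The functor of points of frames. A point of `L` is a frame homomorphism `L → Prop`, that is, the
membership predicate of a completely prime filter. -/
noncomputable def framePoints : Frm.{u}ᵒᵖ ⥤ TopCat.{u} := Locale.pt

/-- The dual adjunction between topological spaces and frames. -/
noncomputable def adjunctionTopFrm : topCatOpToFrm.{u}.rightOp ⊣ framePoints.{u} :=
  Locale.adjunctionTopToLocalePT

/-- A frame is compact if every cover of its top element has a finite subcover. -/
def IsCompactFrame (L : Type u) [Order.Frame L] : Prop :=
  ∀ S : Set L, sSup S = ⊤ → ∃ T ⊆ S, T.Finite ∧ sSup T = ⊤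

/-- A frame is regular if every element `a` is the join of the elements `b` that are well inside
`a`, that is, whose pseudocomplement joins with `a` to the top. -/
def IsRegularFrame (L : Type u) [Order.Frame L] : Prop :=
  ∀ a : L, a = sSup {b | bᶜ ⊔ a = ⊤}

/-! ### The categories -/

/-- Compact Hausdorff MT-algebras. -/
def KHMT : ObjectProperty MTCat.{u} := fun M => MTAlgebra.IsCompact M ∧ MTAlgebra.IsHausdorff M

/-- Spatial (that is, atomic) MT-algebras. -/
def SMT : ObjectProperty MTCat.{u} := fun M => IsAtomic M

/-- Compact regular frames. -/
def KRegFrm : ObjectProperty Frm.{u} := fun L => IsCompactFrame L ∧ IsRegularFrame L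

/-- Compact Hausdorff spaces. -/
def KHaus : ObjectProperty TopCat.{u} := fun X => CompactSpace X ∧ T2Space X

section Restriction

variable {C : Type*} {D : Type*} [Category C] [Category D]

/-- The functor `F` restricts to an equivalence between the full subcategories given by `P`, `Q`. -/
def RestrictsToEquivalence (F : C ⥤ D) (P : ObjectProperty C) (Q : ObjectProperty D) : Prop :=
  ∃ h : ∀ X : P.FullSubcategory, Q ((P.ι ⋙ F).obj X), (Q.lift (P.ι ⋙ F) h).IsEquivalence

/-- A dual adjunction between contravariant functors `F` and `G` restricts to a dual equivalence
between the full subcategories given by `P` and `Q`: both functors restrict, the restrictions are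
equivalences, and the two units of the dual adjunction are isomorphisms on the subcategories. -/
def RestrictsToDualEquivalence {F : Cᵒᵖ ⥤ D} {G : Dᵒᵖ ⥤ C} (adj : F.rightOp ⊣ G)
    (P : ObjectProperty C) (Q : ObjectProperty D) : Prop :=
  ∃ (hF : ∀ X : P.FullSubcategoryᵒᵖ, Q ((P.ι.op ⋙ F).obj X))
    (hG : ∀ Y : Q.FullSubcategoryᵒᵖ, P ((Q.ι.op ⋙ G).obj Y)),
    (Q.lift (P.ι.op ⋙ F) hF).IsEquivalence ∧ (P.lift (Q.ι.op ⋙ G) hG).IsEquivalence ∧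
    (∀ X : C, P X → IsIso (adj.unit.app X)) ∧ (∀ Y : D, Q Y → IsIso (adj.counit.app (op Y)))

end Restriction

/-! A dual adjunction restricts to a dual equivalence once both functors restrict and both units are
isomorphisms there, so each duality reduces to statements about objects. Compactness supplies
coatoms, which replace maximal ideals throughout.

In a compact regular frame, coatoms give enough points (`exists_point_of_not_le`), so the frame is
that of the open sets of its points; regularity makes points separable by disjoint elements
(`exists_disjoint_of_point_ne`), which gives both the Hausdorff property of the point space and the
sobriety of compact Hausdorff spaces.

In a compact Hausdorff MT-algebra, complements of suitable coatoms of the frame of open elements are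
atoms (`isAtomic_of_isCompact_of_isHausdorff`), so the algebra is the powerset of its space of
atoms. Finally `𝒪 ∘ 𝒫 ≅ Ω`, and two of these three functors are already known to be equivalences on
the subcategories, so `𝒪` is one too. -/

/-! ### Restricting dual adjunctions -/

section Restriction

variable {C : Type*} {D : Type*} [Category C] [Category D]

/-- A dual adjunction restricts to a dual equivalence as soon as both functors restrict and both
units are isomorphisms on the subcategories. -/
theorem restrictsToDualEquivalence_of_isIso {F : Cᵒᵖ ⥤ D} {G : Dᵒᵖ ⥤ C} (adj : F.rightOp ⊣ G)
    {P : ObjectProperty C} {Q : ObjectProperty D}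
    (hF : ∀ X, P X → Q (F.obj (op X))) (hG : ∀ Y, Q Y → P (G.obj (op Y)))
    (hunit : ∀ X : C, P X → IsIso (adj.unit.app X))
    (hcounit : ∀ Y : D, Q Y → IsIso (adj.counit.app (op Y))) :
    RestrictsToDualEquivalence adj P Q := by
  let F' : P.FullSubcategoryᵒᵖ ⥤ Q.FullSubcategory :=
    Q.lift (P.ι.op ⋙ F) fun X => hF _ X.unop.property
  let G' : Q.FullSubcategoryᵒᵖ ⥤ P.FullSubcategory :=
    P.lift (Q.ι.op ⋙ G) fun Y => hG _ Y.unop.property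
  let α : 𝟭 P.FullSubcategory ≅ F'.rightOp ⋙ G' :=
    NatIso.ofComponents
      (fun X => P.isoMk (X := X) (Y := (F'.rightOp ⋙ G').obj X)
        (@asIso _ _ _ _ (adj.unit.app X.obj) (hunit _ X.property)))
      (fun f => ObjectProperty.hom_ext _ (adj.unit.naturality f.hom))
  let β : G' ⋙ F'.rightOp ≅ 𝟭 Q.FullSubcategoryᵒᵖ :=
    NatIso.ofComponents
      (fun Y => (Q.isoMk (X := Y.unop) (Y := ((G' ⋙ F'.rightOp).obj Y).unop)
        (@asIso _ _ _ _ (adj.counit.app (op Y.unop.obj)) (hcounit _ Y.unop.property)).unop).op)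
      (fun f => Quiver.Hom.unop_inj (ObjectProperty.hom_ext _
        (congrArg Quiver.Hom.unop (adj.counit.naturality f.unop.hom.op))))
  -- Only natural isomorphisms are needed here, not triangle identities; `leftOp` then turns the
  -- functor of `e` back into `F'`.
  let e : P.FullSubcategory ≌ Q.FullSubcategoryᵒᵖ := CategoryTheory.Equivalence.mk F'.rightOp G' α β
  exact ⟨fun X => hF _ X.unop.property, fun Y => hG _ Y.unop.property,
    e.leftOp.isEquivalence_functor, e.isEquivalence_inverse, hunit, hcounit⟩

end Restriction

/-! ### Compact regular frames -/

theorem isCompactFrame_iff_isCompactElement_top {L : Type u} [Order.Frame L] :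
    IsCompactFrame L ↔ IsCompactElement (⊤ : L) := by
  rw [CompleteLattice.isCompactElement_iff_exists_le_sSup_of_le_sSup]
  constructor
  · intro h S hS
    obtain ⟨T, hTS, hT, hT'⟩ := h S (top_le_iff.mp hS)
    refine ⟨hT.toFinset, by simpa using hTS, ?_⟩
    rw [Finset.sup_id_eq_sSup, hT.coe_toFinset, hT']
  · intro h S hS
    obtain ⟨T, hTS, hT⟩ := h S hS.ge
    exact ⟨T, hTS, T.finite_toSet, top_le_iff.mp (by rwa [← Finset.sup_id_eq_sSup])⟩

theorem isCompactFrame_opens_iff {X : Type u} [TopologicalSpace X] :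
    IsCompactFrame (Opens X) ↔ CompactSpace X := by
  rw [isCompactFrame_iff_isCompactElement_top, Opens.isCompactElement_iff, Opens.coe_top,
    isCompact_univ_iff]

/-- Zorn's lemma applies because compactness keeps the join of a nonempty chain of proper elements
proper. -/
theorem IsCompactFrame.isCoatomic {L : Type u} [Order.Frame L] (h : IsCompactFrame L) :
    IsCoatomic L :=
  CompleteLattice.coatomic_of_top_compact (isCompactFrame_iff_isCompactElement_top.mp h)

theorem IsCompactFrame.of_orderIso {L : Type u} {K : Type v} [Order.Frame L] [Order.Frame K]
    (e : L ≃o K) (h : IsCompactFrame L) : IsCompactFrame K := by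
  intro S hS
  obtain ⟨T, hTS, hT, hT'⟩ := h (e.symm '' S) (by rw [← map_sSup, hS, map_top])
  refine ⟨e '' T, ?_, hT.image _, by rw [← map_sSup, hT', map_top]⟩
  rintro _ ⟨t, ht, rfl⟩
  obtain ⟨s, hs, rfl⟩ := hTS ht
  simpa using hs

theorem IsRegularFrame.of_orderIso {L : Type u} {K : Type v} [Order.Frame L] [Order.Frame K]
    (e : L ≃o K) (h : IsRegularFrame L) : IsRegularFrame K := by
  intro a
  refine le_antisymm ?_ (sSup_le fun b hb => ?_)
  · rw [← e.symm.le_iff_le, h (e.symm a)]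
    refine sSup_le fun b hb => e.le_symm_apply.mpr (le_sSup ?_)
    have hb' : bᶜ ⊔ e.symm a = ⊤ := hb
    have := congrArg e hb'
    simpa [map_compl] using this
  · have hb' : bᶜ ⊔ a = ⊤ := hb
    calc b = b ⊓ (bᶜ ⊔ a) := by rw [hb', inf_top_eq]
      _ ≤ a := by rw [inf_sup_left, inf_compl_self, bot_sup_eq]; exact inf_le_right

/-- The point of a frame given by a coatom. -/
def pointOfIsCoatom {L : Type u} [Order.Frame L] (w : L) (hw : IsCoatom w) : Locale.PT L where
  toFun a := ¬ a ≤ w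
  map_inf' a b := by
    refine propext ⟨fun h => ⟨fun ha => h (inf_le_left.trans ha),
      fun hb => h (inf_le_right.trans hb)⟩, fun ⟨ha, hb⟩ hab => ?_⟩
    -- A coatom is prime: if neither `a` nor `b` lies below `w`, distributivity gives `w ⊔ (a ⊓ b) =
    -- ⊤`.
    have ha' : w ⊔ a = ⊤ := hw.2 _ (left_lt_sup.mpr ha)
    have hb' : w ⊔ b = ⊤ := hw.2 _ (left_lt_sup.mpr hb)
    exact hw.1 (by rw [← sup_eq_left.mpr hab, sup_inf_left, ha', hb', inf_top_eq])
  map_top' := eq_true fun h => hw.1 (top_le_iff.mp h)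
  map_sSup' S := by simp [Prop.exists_iff]

/-- Regularity gives `c` well inside `a` with `c ≰ b`. Then `b ⊔ cᶜ` is proper, and a coatom above
it cannot be above `a`, since `cᶜ ⊔ a = ⊤`. -/
theorem exists_point_of_not_le {L : Type u} [Order.Frame L] (hc : IsCompactFrame L)
    (hr : IsRegularFrame L) {a b : L} (hab : ¬ a ≤ b) : ∃ p : Locale.PT L, p a ∧ ¬ p b := by
  obtain ⟨c, hca, hcb⟩ : ∃ c, cᶜ ⊔ a = ⊤ ∧ ¬ c ≤ b := by
    by_contra! h
    exact hab ((hr a).le.trans (sSup_le h))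
  have := hc.isCoatomic
  rcases eq_top_or_exists_le_coatom (b ⊔ cᶜ) with h | ⟨w, hw, hle⟩
  · refine absurd ?_ hcb
    calc c = c ⊓ (b ⊔ cᶜ) := by rw [h, inf_top_eq]
      _ ≤ b := by rw [inf_sup_left, inf_compl_self, sup_bot_eq]; exact inf_le_right
  · refine ⟨pointOfIsCoatom w hw, fun h => hw.1 ?_, fun h => h (le_sup_left.trans hle)⟩
    exact top_le_iff.mp (hca.ge.trans (sup_le (le_sup_right.trans hle) h))

/-- If `p` holds at `a` and `q` does not, then `p` holds at some `b` well inside `a`, and `q`,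
holding at `bᶜ ⊔ a`, must hold at `bᶜ`. -/
theorem exists_disjoint_of_point_ne {L : Type u} [Order.Frame L] (hr : IsRegularFrame L)
    {p q : Locale.PT L} (hpq : p ≠ q) : ∃ a b : L, p a ∧ q b ∧ a ⊓ b = ⊥ := by
  have key : ∀ {p q : Locale.PT L} {a : L}, p a → ¬ q a → ∃ a b : L, p a ∧ q b ∧ a ⊓ b = ⊥ := by
    intro p q a hp hq
    rw [hr a, map_sSup] at hp
    obtain ⟨_, ⟨b, hb, rfl⟩, hpb⟩ := hp
    have hb' : bᶜ ⊔ a = ⊤ := hb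
    have hq' : q (bᶜ ⊔ a) := by rw [hb', map_top]; trivial
    rw [map_sup] at hq'
    exact ⟨b, bᶜ, hpb, hq'.resolve_right hq, inf_compl_self b⟩
  obtain ⟨a, ha⟩ : ∃ a, p a ≠ q a := by
    by_contra! h
    exact hpq (DFunLike.ext _ _ h)
  by_cases hp : p a
  · exact key hp fun hq => ha (propext ⟨fun _ => hq, fun _ => hp⟩)
  · have hq : q a := by
      by_contra hq
      exact ha (propext ⟨fun h => absurd h hp, fun h => absurd h hq⟩)
    obtain ⟨c, d, hc, hd, hcd⟩ := key hq hp
    exact ⟨d, c, hd, hc, by rwa [inf_comm]⟩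

theorem t2Space_points {L : Type u} [Order.Frame L] (hr : IsRegularFrame L) :
    T2Space (Locale.PT L) := by
  refine ⟨fun p q hpq => ?_⟩
  obtain ⟨a, b, ha, hb, hab⟩ := exists_disjoint_of_point_ne hr hpq
  refine ⟨{x | x a}, {x | x b}, ⟨a, rfl⟩, ⟨b, rfl⟩, ha, hb, ?_⟩
  refine Set.disjoint_left.mpr fun x hxa hxb => ?_
  have : x (a ⊓ b) := by rw [map_inf]; exact ⟨hxa, hxb⟩
  rw [hab, map_bot] at this
  exact this

/-- A compact regular frame is isomorphic to the frame of open sets of its space of points. -/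
noncomputable def opensPointsOrderIso (L : Frm.{u}) (hc : IsCompactFrame L)
    (hr : IsRegularFrame L) : L ≃o Opens (Locale.PT L) :=
  RelIso.ofSurjective
    (OrderEmbedding.ofMapLEIff (Locale.counitAppCont (op L)) fun a b =>
      ⟨fun h => by
        by_contra hab
        obtain ⟨p, hpa, hpb⟩ := exists_point_of_not_le hc hr hab
        exact hpb (h hpa), fun h => OrderHomClass.mono _ h⟩)
    (by
      rintro ⟨U, u, rfl⟩
      exact ⟨u, rfl⟩)

theorem isIso_adjunctionTopFrm_counit_app (L : Frm.{u}) (hL : KRegFrm L) :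
    IsIso (adjunctionTopFrm.counit.app (op L)) :=
  (Frm.Iso.mk (opensPointsOrderIso L hL.1 hL.2) :
    L ≅ Frm.of (Opens (Locale.PT L))).op.isIso_hom

theorem kHaus_framePoints (L : Frm.{u}) (hL : KRegFrm L) : KHaus (framePoints.obj (op L)) :=
  ⟨isCompactFrame_opens_iff.mp (hL.1.of_orderIso (opensPointsOrderIso L hL.1 hL.2)),
    t2Space_points hL.2⟩

/-! ### Frames of open sets of compact Hausdorff spaces -/

theorem isRegularFrame_opens (X : Type u) [TopologicalSpace X] [RegularSpace X] :
    IsRegularFrame (Opens X) := by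
  intro U
  refine le_antisymm (fun x hx => ?_) (sSup_le fun V hV => ?_)
  · obtain ⟨K, ⟨hxK, hK⟩, hKU⟩ := (closed_nhds_basis x).mem_iff.mp (U.isOpen.mem_nhds hx)
    refine Opens.mem_sSup.mpr ⟨⟨interior K, isOpen_interior⟩, ?_, mem_interior_iff_mem_nhds.mpr hxK⟩
    -- The interior of a closed neighbourhood `K ⊆ U` is well inside `U`: its pseudocomplement
    -- contains `Kᶜ`, and `K` is covered by `U`.
    have hle : (⟨Kᶜ, hK.isOpen_compl⟩ : Opens X) ≤ (⟨interior K, isOpen_interior⟩ : Opens X)ᶜ := by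
      rw [le_compl_iff_disjoint_right, disjoint_iff]
      ext y
      simp only [Opens.coe_inf, Opens.coe_mk, Opens.coe_bot, Set.mem_inter_iff, Set.mem_compl_iff,
        Set.mem_empty_iff_false, iff_false, not_and]
      exact fun hy hy' => hy (interior_subset hy')
    refine top_le_iff.mp (le_trans (fun y _ => ?_) (sup_le_sup_right hle U))
    by_cases hy : y ∈ K
    · exact Or.inr (hKU hy)
    · exact Or.inl hy
  · have hV' : Vᶜ ⊔ U = ⊤ := hV
    calc V = V ⊓ (Vᶜ ⊔ U) := by rw [hV', inf_top_eq]
      _ ≤ U := by rw [inf_sup_left, inf_compl_self, bot_sup_eq]; exact inf_le_right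

theorem kRegFrm_opens (X : TopCat.{u}) (hX : KHaus X) : KRegFrm (topCatOpToFrm.obj (op X)) := by
  obtain ⟨_, _⟩ := hX
  exact ⟨isCompactFrame_opens_iff.mpr ‹_›, isRegularFrame_opens X⟩

theorem localePointOfSpacePoint_bijective (X : Type u) [TopologicalSpace X] [CompactSpace X]
    [T2Space X] : Function.Bijective (Locale.localePointOfSpacePoint X) := by
  constructor
  · intro x y hxy
    by_contra hne
    obtain ⟨U, V, hU, hV, hx, hy, hUV⟩ := t2_separation hne
    have h : (x ∈ (⟨U, hU⟩ : Opens X)) = (y ∈ (⟨U, hU⟩ : Opens X)) := DFunLike.congr_fun hxy _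
    exact Set.disjoint_left.mp hUV (h.mp hx) hy
  · intro p
    -- The largest open set where `p` fails is proper, and any `x` outside it represents `p`:
    -- otherwise disjoint elements separate the two points, and the one containing `x` is an open
    -- set where `p` fails.
    have hW : ¬ p (sSup {u | ¬ p u}) := by
      rw [map_sSup]
      rintro ⟨_, ⟨u, hu, rfl⟩, h⟩
      exact hu h
    obtain ⟨x, hx⟩ : ∃ x, x ∉ sSup {u : Opens X | ¬ p u} := by
      by_contra! h
      refine hW ?_
      rw [show sSup {u : Opens X | ¬ p u} = ⊤ from top_le_iff.mp fun x _ => h x, map_top]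
      trivial
    refine ⟨x, ?_⟩
    by_contra hne
    obtain ⟨u, v, hu, hv, huv⟩ := exists_disjoint_of_point_ne (isRegularFrame_opens X) hne
    refine hx (Opens.mem_sSup.mpr ⟨u, fun h => ?_, hu⟩)
    have : p (u ⊓ v) := by rw [map_inf]; exact ⟨h, hv⟩
    rw [huv, map_bot] at this
    exact this

theorem isIso_adjunctionTopFrm_unit_app (X : TopCat.{u}) (hX : KHaus X) :
    IsIso (adjunctionTopFrm.unit.app X) := by
  have hX' := kHaus_framePoints _ (kRegFrm_opens X hX)
  obtain ⟨_, _⟩ := hX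
  let f : X → Locale.PT (Opens X) := Locale.localePointOfSpacePoint X
  have : T2Space (Locale.PT (Opens X)) := hX'.2
  have hf : Continuous f := (adjunctionTopFrm.unit.app X).hom.continuous
  have hhomeo : IsHomeomorph f :=
    isHomeomorph_iff_continuous_bijective.mpr ⟨hf, localePointOfSpacePoint_bijective X⟩
  exact (TopCat.isoOfHomeo (X := X) (Y := TopCat.of (Locale.PT (Opens X)))
    hhomeo.homeomorph).isIso_hom

theorem restrictsToDualEquivalence_adjunctionTopFrm :
    RestrictsToDualEquivalence adjunctionTopFrm.{u} KHaus KRegFrm :=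
  restrictsToDualEquivalence_of_isIso _ kRegFrm_opens kHaus_framePoints
    isIso_adjunctionTopFrm_unit_app isIso_adjunctionTopFrm_counit_app

/-! ### Compact Hausdorff MT-algebras -/

namespace MTAlgebra

variable {B : Type u} [MTAlgebra B]

/-- Joins of open elements are computed in the algebra, so covers agree on both sides. -/
theorem isCompact_iff_isCompactFrame : IsCompact B ↔ IsCompactFrame (OpenElts B) := by
  constructor
  · intro h S hS
    obtain ⟨T, hTS, hT, hT'⟩ := h (Subtype.val '' S) (by rintro _ ⟨a, _, rfl⟩; exact a.2)
      (by rw [← OpenElts.coe_sSup, hS, OpenElts.coe_top])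
    obtain ⟨T, hTS', rfl⟩ := Set.subset_image_iff.mp hTS
    exact ⟨T, hTS', hT.of_finite_image Subtype.val_injective.injOn,
      Subtype.ext (top_le_iff.mp hT')⟩
  · intro h S hS hS'
    have himage : Subtype.val '' (Subtype.val ⁻¹' S : Set (OpenElts B)) = S :=
      Set.image_preimage_eq_of_subset fun s hs => ⟨⟨s, hS s hs⟩, rfl⟩
    obtain ⟨T, hTS, hT, hT'⟩ := h (Subtype.val ⁻¹' S)
      (Subtype.ext (by rw [OpenElts.coe_sSup, himage]; exact top_le_iff.mp hS'))
    refine ⟨Subtype.val '' T, Set.image_subset_iff.mpr hTS, hT.image _, ?_⟩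
    rw [← OpenElts.coe_sSup, hT', OpenElts.coe_top]

/-- Such an element is a meet of closed elements `dia (box c)`, hence closed. -/
theorem IsApproxFromAbove.isOpenElt_compl {a : B} (ha : IsApproxFromAbove a) : IsOpenElt aᶜ := by
  rw [show a = _ from ha, compl_sInf]
  refine isOpenElt_sSup ?_
  rintro _ ⟨d, rfl⟩
  refine isOpenElt_sSup ?_
  rintro _ ⟨⟨c, _, rfl⟩, rfl⟩
  simp only [dia, compl_compl]
  exact isOpenElt_box _

/-- This weak form of join-generation is all that the proofs of atomicity and of Hausdorff
separation of atoms need. -/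
theorem IsHausdorff.exists_isApproxFromAbove_le (h : IsHausdorff B) {b : B} (hb : b ≠ ⊥) :
    ∃ a ≤ b, a ≠ ⊥ ∧ IsApproxFromAbove a := by
  obtain ⟨T, hT, rfl⟩ := h b
  by_contra! hcon
  exact hb (sSup_eq_bot.mpr fun a ha => by_contra fun hne => hcon a (le_sSup ha) hne (hT ha))

theorem isAtomic_of_isCompact_of_isHausdorff (hc : IsCompact B) (hh : IsHausdorff B) :
    IsAtomic B := by
  have := (isCompact_iff_isCompactFrame.mp hc).isCoatomic
  refine ⟨fun b => or_iff_not_imp_left.mpr fun hb => ?_⟩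
  obtain ⟨a, hab, ha, ha'⟩ := hh.exists_isApproxFromAbove_le hb
  -- The coatom is taken among open elements, so a priori its complement is minimal only among
  -- nonzero closed elements.
  rcases eq_top_or_exists_le_coatom (⟨aᶜ, ha'.isOpenElt_compl⟩ : OpenElts B) with h | ⟨w, hw, hle⟩
  · exact absurd (compl_eq_top.mp (congrArg Subtype.val h)) ha
  · have hwa : w.1ᶜ ≤ a := compl_le_iff_compl_le.mp hle
    refine ⟨w.1ᶜ, ⟨fun h => hw.1 (Subtype.ext (compl_eq_bot.mp h)), fun x hx => ?_⟩,
      hwa.trans hab⟩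
    by_contra hne
    -- Hausdorffness puts a nonzero closed `c` below any nonzero `x`, so minimality extends to all
    -- elements.
    obtain ⟨c, hcx, hc0, hc'⟩ := hh.exists_isApproxFromAbove_le hne
    have hlt : w < (⟨cᶜ, hc'.isOpenElt_compl⟩ : OpenElts B) := by
      change w.1 < cᶜ
      rw [← compl_lt_compl_iff_lt, compl_compl]
      exact hcx.trans_lt hx
    exact hc0 (compl_eq_top.mp (congrArg Subtype.val (hw.2 _ hlt)))

end MTAlgebra

/-! ### Spatial MT-algebras -/

namespace MTAtoms

open MTAlgebra

variable {M : Type u} [MTAlgebra M]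

theorem eta_subset_eta_iff [IsAtomic M] {a b : M} : eta a ⊆ eta b ↔ a ≤ b := by
  refine ⟨fun h => ?_, fun h x hx => le_trans hx h⟩
  rw [← disjoint_compl_right_iff, disjoint_iff]
  by_contra hne
  obtain ⟨x, hx, hle⟩ := (eq_bot_or_exists_atom_le (a ⊓ bᶜ)).resolve_left hne
  have hxb : x ≤ b := h (show (⟨x, hx⟩ : MTAtoms M) ∈ eta a from hle.trans inf_le_left)
  exact hx.1 (le_bot_iff.mp ((le_inf hxb (hle.trans inf_le_right)).trans (inf_compl_self b).le))

/-- Atomicity plays no role: an atom below a join of atoms is one of them. -/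
theorem eta_surjective : Function.Surjective (eta : M → Set (MTAtoms M)) := by
  intro S
  refine ⟨sSup (Subtype.val '' S), ?_⟩
  rw [eta_sSup]
  ext x
  simp only [Set.iSup_eq_iUnion, Set.mem_iUnion]
  constructor
  · rintro ⟨_, ⟨y, hy, rfl⟩, hxy⟩
    have : x = y := Subtype.ext ((y.2.le_iff_eq x.2.1).mp hxy)
    exact this ▸ hy
  · exact fun hx => ⟨x.1, ⟨x, hx, rfl⟩, le_rfl⟩

/-- This upgrades the lattice isomorphism `eta` to one of MT-algebras: an open set inside `eta a` is
some `eta u` with `u` open, and `u ≤ a` forces `u ≤ box a`. -/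
theorem interior_eta [IsAtomic M] (a : M) : interior (eta a) = eta (box a) := by
  let := powersetMT (MTAtoms M)
  refine Set.Subset.antisymm ?_ ((etaHom M).map_box_le a)
  obtain ⟨u, hu, hua⟩ : IsOpen (interior (eta a)) := isOpen_interior
  rw [← hua, eta_subset_eta_iff]
  have hle : u ≤ a := eta_subset_eta_iff.mp (hua.le.trans interior_subset)
  exact hu.le.trans (box_mono hle)

variable (M) in
/-- An atomic MT-algebra is isomorphic, as a lattice, to the powerset of its atoms. -/
noncomputable def etaOrderIso [IsAtomic M] : M ≃o Set (MTAtoms M) :=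
  RelIso.ofSurjective (OrderEmbedding.ofMapLEIff eta fun _ _ => eta_subset_eta_iff) eta_surjective

variable (M) in
/-- The inverse of `etaHom` for an atomic MT-algebra. -/
noncomputable def etaInvHom [IsAtomic M] :
    letI := powersetMT (MTAtoms M)
    MTHom (Set (MTAtoms M)) M :=
  letI := powersetMT (MTAtoms M)
  { toFun := (etaOrderIso M).symm
    map_sInf' := fun S => map_sInf (etaOrderIso M).symm S
    map_sSup' := fun S => map_sSup (etaOrderIso M).symm S
    map_box_le' := fun S => by
      obtain ⟨a, rfl⟩ := (etaOrderIso M).surjective S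
      rw [OrderIso.symm_apply_apply]
      exact ((etaOrderIso M).symm_apply_le).mpr (interior_eta a).le }

variable (M) in
/-- The open elements of an atomic MT-algebra are the open sets of its space of atoms. -/
noncomputable def openEltsOrderIso [IsAtomic M] : OpenElts M ≃o Opens (MTAtoms M) :=
  RelIso.ofSurjective
    (OrderEmbedding.ofMapLEIff (fun u => (⟨eta u.1, u.1, u.2, rfl⟩ : Opens (MTAtoms M)))
      fun a b => eta_subset_eta_iff (a := a.1) (b := b.1))
    (by
      rintro ⟨U, u, hu, rfl⟩
      exact ⟨⟨u, hu⟩, rfl⟩)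

theorem compactSpace (hc : IsCompact M) [IsAtomic M] : CompactSpace (MTAtoms M) :=
  isCompactFrame_opens_iff.mp
    ((isCompact_iff_isCompactFrame.mp hc).of_orderIso (openEltsOrderIso M))

theorem t2Space (hh : IsHausdorff M) : T2Space (MTAtoms M) := by
  refine ⟨fun x y hxy => ?_⟩
  obtain ⟨a, hax, ha, ha'⟩ := hh.exists_isApproxFromAbove_le x.2.1
  -- An atom is itself approximated from above, being the only nonzero element below it.
  obtain rfl : a = x.1 := (x.2.le_iff_eq ha).mp hax
  have hyx : ¬ y.1 ≤ x.1 := fun h => hxy (Subtype.ext ((x.2.le_iff_eq y.2.1).mp h)).symm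
  obtain ⟨c, hxc, hyc⟩ : ∃ c, x.1 ≤ box c ∧ ¬ y.1 ≤ dia (box c) := by
    by_contra! h
    refine hyx (le_trans (le_sInf ?_) (show x.1 = _ from ha').ge)
    rintro _ ⟨c, hc, rfl⟩
    exact h c hc
  -- An atom not below `dia (box c)` lies below its complement, which is open and disjoint from `box
  -- c`.
  have hyc' : y.1 ≤ box (box c)ᶜ := by
    rcases y.2.le_iff.mp (inf_le_left : y.1 ⊓ dia (box c) ≤ y.1) with h | h
    · have := (disjoint_iff.mpr h).le_compl_right
      rwa [dia, compl_compl] at this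
    · exact absurd (inf_eq_left.mp h) hyc
  refine ⟨eta (box c), eta (box (box c)ᶜ), ⟨_, isOpenElt_box _, rfl⟩, ⟨_, isOpenElt_box _, rfl⟩,
    hxc, hyc', Set.disjoint_left.mpr fun z hz hz' => z.2.1 (le_bot_iff.mp ?_)⟩
  exact (le_inf hz (le_trans hz' (box_le _))).trans (inf_compl_self _).le

end MTAtoms

/-! ### The dualities -/

theorem isIso_adjunctionTopMT_counit_app (M : MTCat.{u}) (hM : SMT M) :
    IsIso (adjunctionTopMT.counit.app (op M)) := by
  have : IsAtomic M := hM
  let e : M ≅ powersetFunctor.obj (op (TopCat.of (MTAtoms M))) :=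
    { hom := MTAtoms.etaHom M
      inv := MTAtoms.etaInvHom M
      hom_inv_id := MTHom.ext fun a => (MTAtoms.etaOrderIso M).symm_apply_apply a
      inv_hom_id := MTHom.ext fun a => (MTAtoms.etaOrderIso M).apply_symm_apply a }
  exact e.op.isIso_hom

/-- No separation axiom is needed: the atoms of a powerset are the singletons and its open elements
the open sets. -/
theorem isIso_epsilon (X : TopCat.{u}) : IsIso (epsilon X) := by
  let f : X → atomFunctor.obj (op (powersetFunctor.obj (op X))) := epsilon X
  have hf : IsHomeomorph f := by
    refine ⟨(epsilon X).hom.continuous, fun U hU => ⟨U, hU.interior_eq.symm, ?_⟩,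
      fun x y hxy => ?_, fun x => ?_⟩
    · ext x
      obtain ⟨y, hy⟩ := Set.isAtom_iff.mp x.2
      obtain rfl : f y = x := Subtype.ext hy.symm
      refine ⟨fun h => ⟨y, Set.singleton_subset_iff.mp h, rfl⟩, ?_⟩
      rintro ⟨z, hz, hzy⟩
      rw [← hzy]
      exact Set.singleton_subset_iff.mpr hz
    · exact Set.singleton_injective (congrArg Subtype.val hxy)
    · obtain ⟨y, hy⟩ := Set.isAtom_iff.mp x.2
      exact ⟨y, Subtype.ext hy.symm⟩
  exact (TopCat.isoOfHomeo hf.homeomorph).isIso_hom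

theorem kHaus_atomFunctor (M : MTCat.{u}) (hM : KHMT M) : KHaus (atomFunctor.obj (op M)) := by
  have := MTAlgebra.isAtomic_of_isCompact_of_isHausdorff hM.1 hM.2
  exact ⟨MTAtoms.compactSpace hM.1, MTAtoms.t2Space hM.2⟩

/-- The open elements of a powerset are the open sets. -/
def openEltsPowersetOrderIso (X : Type u) [TopologicalSpace X] :
    letI := powersetMT X
    OpenElts (Set X) ≃o Opens X :=
  letI := powersetMT X
  { toFun := fun U => ⟨U.1, interior_eq_iff_isOpen.mp U.2.symm⟩
    invFun := fun U => ⟨U.1, U.2.interior_eq.symm⟩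
    left_inv := fun _ => rfl
    right_inv := fun _ => rfl
    map_rel_iff' := Iff.rfl }

theorem isHausdorff_powersetMT (X : Type u) [TopologicalSpace X] [T2Space X] :
    letI := powersetMT X
    MTAlgebra.IsHausdorff (Set X) := by
  let := powersetMT X
  intro A
  -- Singletons generate: each is the meet of the closures of its open neighbourhoods, by Hausdorff
  -- separation.
  refine ⟨(fun x => {x}) '' A, ?_, ?_⟩
  · rintro _ ⟨x, _, rfl⟩
    refine le_antisymm (le_sInf ?_) (fun y hy => ?_)
    · rintro _ ⟨c, hc, rfl⟩
      refine hc.trans (le_compl_comm.mp (MTAlgebra.box_le _))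
    · by_contra hne
      obtain ⟨U, V, hU, hV, hx, hyV, hUV⟩ := t2_separation (Ne.symm hne)
      have hbox : MTAlgebra.box U = U := hU.interior_eq
      have hy' : y ∈ MTAlgebra.dia (MTAlgebra.box U) :=
        hy _ ⟨U, by rw [hbox]; exact Set.singleton_subset_iff.mpr hx, rfl⟩
      rw [hbox] at hy'
      exact hy' (interior_maximal (fun z hz hzU => Set.disjoint_left.mp hUV hzU hz) hV hyV)
  · rw [Set.sSup_eq_sUnion, Set.sUnion_image, Set.biUnion_of_singleton]

theorem kHMT_powersetFunctor (X : TopCat.{u}) (hX : KHaus X) :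
    KHMT (powersetFunctor.obj (op X)) := by
  obtain ⟨_, _⟩ := hX
  let := powersetMT X
  exact ⟨MTAlgebra.isCompact_iff_isCompactFrame.mpr
    ((isCompactFrame_opens_iff.mpr ‹_›).of_orderIso (openEltsPowersetOrderIso X).symm),
    isHausdorff_powersetMT X⟩

theorem sMT_of_kHMT (M : MTCat.{u}) (hM : KHMT M) : SMT M :=
  MTAlgebra.isAtomic_of_isCompact_of_isHausdorff hM.1 hM.2

theorem restrictsToDualEquivalence_adjunctionTopMT :
    RestrictsToDualEquivalence adjunctionTopMT.{u} KHaus KHMT :=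
  restrictsToDualEquivalence_of_isIso _ kHMT_powersetFunctor kHaus_atomFunctor
    (fun X _ => isIso_epsilon X)
    (fun M hM => isIso_adjunctionTopMT_counit_app M (sMT_of_kHMT M hM))

/-- The open elements of the powerset of a space form its frame of open sets, naturally. -/
def powersetCompOpenIso :
    powersetFunctor.{u} ⋙ MTCat.openFunctor.{u} ≅ topCatOpToFrm.{u} :=
  NatIso.ofComponents
    (fun X => letI := powersetMT X.unop
      (Frm.Iso.mk (openEltsPowersetOrderIso X.unop) :
        Frm.of (OpenElts (Set X.unop)) ≅ Frm.of (Opens X.unop)))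
    (fun _ => rfl)

/-- Regularity is not checked in the algebra but transported from the compact Hausdorff space of
atoms. -/
theorem kRegFrm_openFunctor (M : MTCat.{u}) (hM : KHMT M) :
    KRegFrm (MTCat.openFunctor.obj M) := by
  have : IsAtomic M := sMT_of_kHMT M hM
  obtain ⟨hc, hr⟩ := kRegFrm_opens _ (kHaus_atomFunctor M hM)
  exact ⟨hc.of_orderIso (MTAtoms.openEltsOrderIso M).symm,
    hr.of_orderIso (MTAtoms.openEltsOrderIso M).symm⟩

theorem restrictsToEquivalence_openFunctor :
    RestrictsToEquivalence MTCat.openFunctor.{u} KHMT KRegFrm := by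
  refine ⟨fun M => kRegFrm_openFunctor M.obj M.property, ?_⟩
  obtain ⟨hP, -, hP', -⟩ := restrictsToDualEquivalence_adjunctionTopMT.{u}
  obtain ⟨hΩ, -, hΩ', -⟩ := restrictsToDualEquivalence_adjunctionTopFrm.{u}
  -- On compact Hausdorff spaces `𝒪 ∘ 𝒫 ≅ Ω`; since `𝒫` and `Ω` are equivalences there, cancelling
  -- `𝒫` makes `𝒪` one.
  let e : KHMT.lift (KHaus.ι.op ⋙ powersetFunctor) hP ⋙ KRegFrm.lift
      (KHMT.ι ⋙ MTCat.openFunctor) (fun M => kRegFrm_openFunctor M.obj M.property) ≅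
      KRegFrm.lift (KHaus.ι.op ⋙ topCatOpToFrm) hΩ :=
    NatIso.ofComponents (fun X => KRegFrm.isoMk (powersetCompOpenIso.app (op X.unop.obj)))
      (fun f => ObjectProperty.hom_ext _ (powersetCompOpenIso.hom.naturality f.unop.hom.op))
  have := Functor.isEquivalence_of_iso e.symm
  exact Functor.isEquivalence_of_comp_left (KHMT.lift (KHaus.ι.op ⋙ powersetFunctor) hP) _

theorem mainTheorem9 :
    RestrictsToEquivalence MTCat.openFunctor.{u} KHMT KRegFrm ∧
    (∀ M : MTCat.{u}, KHMT M → SMT M) ∧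
    RestrictsToDualEquivalence adjunctionTopMT.{u} KHaus KHMT ∧
    RestrictsToDualEquivalence adjunctionTopFrm.{u} KHaus KRegFrm ∧
    Nonempty (KRegFrm.{u}.FullSubcategoryᵒᵖ ≌ KHaus.{u}.FullSubcategory) := by
  refine ⟨restrictsToEquivalence_openFunctor, sMT_of_kHMT,
    restrictsToDualEquivalence_adjunctionTopMT, restrictsToDualEquivalence_adjunctionTopFrm, ?_⟩
  obtain ⟨_, hG, _, hG', _⟩ := restrictsToDualEquivalence_adjunctionTopFrm.{u}
  exact ⟨(KHaus.lift (KRegFrm.ι.op ⋙ framePoints) hG).asEquivalence⟩
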